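/- Let $\mathcal C$ be a Grothendieck category with a set $\{G_i\}_{i\in\Lambda}$ of finitely generated projective generators, and let $(U,\theta,\eta)$ be a monad on $\mathcal C$ whose underlying functor is exact and preserves colimits. Let $EM_U$ be the Eilenberg–Moore category of $U$-modules $(M,f_M)$ (an abelian category); write $UG_i$ for the free module $(UG_i,\theta_{G_i})$. Let $\delta:U\to U$ be a derivation on $U$, i.e. a natural transformation with $\theta_X\circ(U\delta_X+\delta_{UX})=\delta_X\circ\theta_X$ for all $X\in\mathcal C$. A $\delta$-derivation on a $U$-module $(M,f_M)$ is a morphism $D:M\to M$ in $\mathcal C$ with $f_M\circ(UD+\delta_M)=D\circ f_M$. Let $\tau=(\mathcal T,\mathcal F)$ be a hereditary torsion theory on $EM_U$. For $X \in EM_U$ let $\mathcal L_X$ be the set of subobjects $I\subseteq X$ in $EM_U$ with $X/I\in\mathcal T$. For $M\in EM_U$ let $M_\tau$ be the sum of all subobjects of $M$ that belong to $\mathcal T$, and let $p:M\to M/M_\tau$ be the canonical epimorphism. A module of quotients of $M$ is an object $H_\tau(M)$ of $EM_U$ together with isomorphisms of abelian groups $$EM_U(UG_i,H_\tau(M))\;\cong\;\varinjlim_{I\in\mathcal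 L_{UG_i}}EM_U(I,M/M_\tau)\qquad(i\in\Lambda),$$ natural with respect to all morphisms $UG_j\to UG_i$ in $EM_U$, and with a morphism $\Phi_M:M\to H_\tau(M)$ in $EM_U$ such that, for every $i \in \Lambda$ and every $f\in EM_U(UG_i,M)$, the composite $\Phi_M\circ f$ corresponds to the class of $p\circ f$. Theorem. Every $U$-module $M$ has a module of quotients. Moreover, if $D$ is a $\delta$-derivation on $M$ and $(H_\tau(M),\Phi_M)$ is a module of quotients of $M$, then there is a unique $\delta$-derivation $\bar D$ on $H_\tau(M)$ that lifts $D$, i.e. such that $\bar D\circ\Phi_M=\Phi_M\circ D$. -/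

import Mathlib

open CategoryTheory CategoryTheory.Limits

universe w v u

/-! ### The Eilenberg-Moore category of an exact monad is abelian -/

section EilenbergMoore

variable {C : Type u} [Category.{v} C] [Abelian C] (U : Monad C)

/-- A left exact endofunctor of an abelian category is additive. -/
instance monadAdditive [PreservesFiniteLimits U.toFunctor] : U.toFunctor.Additive :=
  Functor.additive_of_preserves_binary_products _

theorem monadAlgebra_hasFiniteLimits : HasFiniteLimits U.Algebra :=
  ⟨fun _ _ _ => ⟨fun F => Monad.hasLimit_of_comp_forget_hasLimit F⟩⟩

theorem monadAlgebra_hasFiniteColimits [PreservesFiniteColimits U.toFunctor] :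
    HasFiniteColimits U.Algebra :=
  ⟨fun _ _ _ => ⟨fun F => Monad.forget_creates_colimits_of_monad_preserves F⟩⟩

theorem monadAlgebra_isIso_coimageImageComparison [PreservesFiniteLimits U.toFunctor]
    [PreservesFiniteColimits U.toFunctor] [HasFiniteLimits U.Algebra]
    [HasFiniteColimits U.Algebra] {X Y : U.Algebra} (f : X ⟶ Y) :
    IsIso (Abelian.coimageImageComparison f) := by
  have : PreservesFiniteLimits U.forget := ⟨fun J _ _ => inferInstance⟩
  have : PreservesFiniteColimits U.forget := ⟨fun J _ _ => inferInstance⟩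
  have : IsIso (U.forget.map (Abelian.coimageImageComparison f)) := by
    have e := Abelian.PreservesCoimageImageComparison.iso U.forget f
    exact ((MorphismProperty.isomorphisms C).arrow_mk_iso_iff e).2
      (inferInstanceAs (IsIso (Abelian.coimageImageComparison (U.forget.map f))))
  exact isIso_of_reflects_iso _ U.forget

/-- The Eilenberg-Moore category of an exact monad on an abelian category is abelian: kernels and
cokernels are created by the forgetful functor, which reflects isomorphisms.  The additive
structure is Mathlib's (morphisms are added in `C`). -/
noncomputable instance monadAlgebraAbelian [PreservesFiniteLimits U.toFunctor]
    [PreservesFiniteColimits U.toFunctor] : Abelian U.Algebra :=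
  have := monadAlgebra_hasFiniteLimits U
  have := monadAlgebra_hasFiniteColimits U
  have := fun {X Y : U.Algebra} (f : X ⟶ Y) => monadAlgebra_isIso_coimageImageComparison U f
  Abelian.ofCoimageImageComparisonIsIso

end EilenbergMoore

/-! ### Finitely generated objects -/

/-- An object is finitely generated if, whenever it is the sum (supremum) of a nonempty upward
directed family of subobjects, it is already a member of that family. -/
def IsFinitelyGeneratedObject {A : Type u} [Category.{v} A] (X : A) : Prop :=
  ∀ S : Set (Subobject X), S.Nonempty → DirectedOn (· ≤ ·) S → IsLUB S ⊤ → ⊤ ∈ S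

/-! ### Hereditary torsion theories, Gabriel filters, modules of quotients -/

/-- A hereditary torsion theory `(𝒯, ℱ)` on an abelian category: `𝒯` and `ℱ` are strict (closed
under isomorphisms) full subcategories, there is no nonzero morphism from an object of `𝒯` to an
object of `ℱ`, each object `Z` sits in a short exact sequence `0 ⟶ X ⟶ Z ⟶ Y ⟶ 0` with
`X ∈ 𝒯` and `Y ∈ ℱ`, and `𝒯` is closed under subobjects. -/
structure HereditaryTorsionTheory (A : Type u) [Category.{v} A] [Abelian A] where
  /-- the torsion class -/
  torsion : ObjectProperty A
  /-- the torsion free class -/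
  torsionFree : ObjectProperty A
  torsion_iso : torsion.IsClosedUnderIsomorphisms
  torsionFree_iso : torsionFree.IsClosedUnderIsomorphisms
  hom_eq_zero : ∀ {X Y : A}, torsion X → torsionFree Y → ∀ f : X ⟶ Y, f = 0
  exists_shortExact : ∀ Z : A, ∃ (X Y : A) (i : X ⟶ Z) (p : Z ⟶ Y) (h : i ≫ p = 0),
    (ShortComplex.mk i p h).ShortExact ∧ torsion X ∧ torsionFree Y
  hereditary : torsion.IsClosedUnderSubobjects

namespace HereditaryTorsionTheory

variable {A : Type u} [Category.{v} A] [Abelian A] (τ : HereditaryTorsionTheory A)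

/-- The sum of all torsion subobjects of `M` exists, and is torsion. -/
theorem exists_isGreatest_torsion (M : A) :
    ∃ S : Subobject M, IsGreatest {N : Subobject M | τ.torsion (N : A)} S := by
  obtain ⟨X, Y, i, p, h, hS, hX, hY⟩ := τ.exists_shortExact M
  have := τ.torsion_iso
  have : Mono i := hS.mono_f
  refine ⟨Subobject.mk i, τ.torsion.prop_of_iso (Subobject.underlyingIso i).symm hX, ?_⟩
  intro N hN
  have hz : N.arrow ≫ p = 0 := τ.hom_eq_zero hN hY _
  exact Subobject.le_mk_of_comm (hS.fIsKernel.lift (KernelFork.ofι _ hz))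
    (hS.fIsKernel.fac (KernelFork.ofι _ hz) WalkingParallelPair.zero)

/-- The torsion subobject `M_τ`: the sum of all subobjects of `M` that belong to `𝒯`. -/
noncomputable def torsionSubobject (M : A) : Subobject M :=
  (τ.exists_isGreatest_torsion M).choose

theorem torsionSubobject_isGreatest (M : A) :
    IsGreatest {N : Subobject M | τ.torsion (N : A)} (τ.torsionSubobject M) :=
  (τ.exists_isGreatest_torsion M).choose_spec

/-- `M_τ` is the sum (supremum) of the torsion subobjects of `M`. -/
theorem torsionSubobject_isLUB (M : A) :
    IsLUB {N : Subobject M | τ.torsion (N : A)} (τ.torsionSubobject M) :=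
  (τ.torsionSubobject_isGreatest M).isLUB

/-- The quotient `M / M_τ`. -/
noncomputable def torsionFreeQuotient (M : A) : A :=
  cokernel (τ.torsionSubobject M).arrow

/-- The canonical epimorphism `p : M ⟶ M / M_τ`. -/
noncomputable def toTorsionFreeQuotient (M : A) : M ⟶ τ.torsionFreeQuotient M :=
  cokernel.π (τ.torsionSubobject M).arrow

/-- The Gabriel filter `ℒ_X`: the subobjects `I` of `X` such that `X / I` is torsion. -/
def gabrielFilter (X : A) : Set (Subobject X) :=
  {I | τ.torsion (cokernel I.arrow)}

theorem top_mem_gabrielFilter (X : A) : (⊤ : Subobject X) ∈ τ.gabrielFilter X := by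
  obtain ⟨Z, _, _, _, _, _, hZ, _⟩ := τ.exists_shortExact X
  have := τ.hereditary
  have h0 : IsZero (cokernel (⊤ : Subobject X).arrow) := isZero_cokernel_of_epi _
  have : Mono (0 : cokernel (⊤ : Subobject X).arrow ⟶ Z) :=
    ⟨fun _ _ _ => h0.eq_of_tgt _ _⟩
  exact τ.torsion.prop_of_mono (0 : cokernel (⊤ : Subobject X).arrow ⟶ Z) hZ

/-- The restriction `Hom(I, N) ⟶ Hom(J, N)` for `J ⊆ I` in `ℒ_X`.  The index set is `ℒ_X` with
the reverse inclusion order, so `I ≤ J` in it means `J ⊆ I`. -/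
noncomputable def restriction (X N : A) (I J : (τ.gabrielFilter X)ᵒᵈ) (h : I ≤ J) :
    (((OrderDual.ofDual I).1 : A) ⟶ N) →+ (((OrderDual.ofDual J).1 : A) ⟶ N) :=
  Preadditive.leftComp N (Subobject.ofLE (OrderDual.ofDual J).1 (OrderDual.ofDual I).1 h)

open Classical in
/-- The abelian group `colim_{I ∈ ℒ_X} Hom(I, N)`. -/
def LocalSections (X N : A) : Type (max u v) :=
  AddCommGroup.DirectLimit
    (fun I : (τ.gabrielFilter X)ᵒᵈ => (((OrderDual.ofDual I).1 : A) ⟶ N)) (τ.restriction X N)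

open Classical in
noncomputable instance (X N : A) : AddCommGroup (τ.LocalSections X N) :=
  inferInstanceAs (AddCommGroup (AddCommGroup.DirectLimit
    (fun I : (τ.gabrielFilter X)ᵒᵈ => (((OrderDual.ofDual I).1 : A) ⟶ N)) (τ.restriction X N)))

open Classical in
/-- The class in `colim_{I ∈ ℒ_X} Hom(I, N)` of a morphism `f : I ⟶ N` with `I ∈ ℒ_X`. -/
noncomputable def germ {X N : A} (I : τ.gabrielFilter X) : ((I.1 : A) ⟶ N) →+ τ.LocalSections X N :=
  AddCommGroup.DirectLimit.of
    (fun I : (τ.gabrielFilter X)ᵒᵈ => (((OrderDual.ofDual I).1 : A) ⟶ N)) (τ.restriction X N)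
    (OrderDual.toDual I)

/-- The canonical morphism `ζ : Hom(X, N) ⟶ colim_{I ∈ ℒ_X} Hom(I, N)`. -/
noncomputable def zeta {X N : A} (f : X ⟶ N) : τ.LocalSections X N :=
  τ.germ ⟨⊤, τ.top_mem_gabrielFilter X⟩ ((⊤ : Subobject X).arrow ≫ f)

/-- A module of quotients `H_τ(M)` of `M`, computed on a family `P` of objects (a set of
generators): an object `H` with isomorphisms
`H(P i) := Hom(P i, H) ≃ colim_{I ∈ ℒ_{P i}} Hom(I, M / M_τ)` that are natural in `P i`, together
with the canonical morphism `Φ_M : M ⟶ H`, which acts on `f : P i ⟶ M` by `f ↦ ζ_i (p ∘ f)`.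
Along `h : P j ⟶ P i`, the right-hand side is contravariant by restriction: the class of
`f : I ⟶ M / M_τ` goes to the class of `f ∘ h'` for any restriction `h' : I' ⟶ I` of `h` to an
`I' ∈ ℒ_{P j}` (for instance `I' = h⁻¹(I)`). -/
structure ModuleOfQuotients {ι : Type w} (P : ι → A) (M : A) where
  /-- the object `H_τ(M)` -/
  obj : A
  /-- the canonical morphism `Φ_M` -/
  unit : M ⟶ obj
  /-- the identification of `H_τ(M)(P i)` -/
  sections : ∀ i, (P i ⟶ obj) ≃+ τ.LocalSections (P i) (τ.torsionFreeQuotient M)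
  sections_naturality : ∀ {i j : ι} (h : P j ⟶ P i) (I : τ.gabrielFilter (P i))
    (I' : τ.gabrielFilter (P j)) (h' : (I'.1 : A) ⟶ (I.1 : A)),
    h' ≫ I.1.arrow = I'.1.arrow ≫ h → ∀ (f : (I.1 : A) ⟶ τ.torsionFreeQuotient M)
    (x : P i ⟶ obj), sections i x = τ.germ I f → sections j (h ≫ x) = τ.germ I' (h' ≫ f)
  sections_unit : ∀ (i : ι) (f : P i ⟶ M),
    sections i (f ≫ unit) = τ.zeta (f ≫ τ.toTorsionFreeQuotient M)

end HereditaryTorsionTheory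

/-! ### Derivations -/

section Derivations

variable {C : Type u} [Category.{v} C] [Preadditive C]

/-- A natural transformation `δ : U ⟶ U` is a derivation on the monad `(U, θ, η)` if
`θ ∘ (1 * δ + δ * 1) = δ ∘ θ`, where `(1 * δ)_X = U(δ_X)` and `(δ * 1)_X = δ_{UX}`. -/
def IsMonadDerivation (U : Monad C) (δ : U.toFunctor ⟶ U.toFunctor) : Prop :=
  ∀ X : C, (U.map (δ.app X) + δ.app (U.obj X)) ≫ U.μ.app X = U.μ.app X ≫ δ.app X

/-- A morphism `D : M ⟶ M` in `C` is a `δ`-derivation on the `U`-module `(M, f_M)` if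
`f_M ∘ (U D + δ_M) = D ∘ f_M`. -/
def IsModuleDerivation (U : Monad C) (δ : U.toFunctor ⟶ U.toFunctor) (M : U.Algebra)
    (D : M.A ⟶ M.A) : Prop :=
  (U.map D + δ.app M.A) ≫ M.a = M.a ≫ D

end Derivations

/-!
Write `A` for the category of `U`-modules. It is a Grothendieck category, and the free modules
`U (G i)` are projective generators of it.

Call an object of `A` closed if it is torsion free and morphisms to it extend along monomorphisms
with torsion cokernel. A torsion free object `N` has an injective hull `Q`, which is torsion free
because `N` is essential in it; the inverse image in `Q` of the torsion subobject of `Q / N` is closed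
and contains `N` with torsion quotient (`exists_closedEnvelope`). For `N = M / M_τ` this is a module of
quotients of `M` (`nonempty_moduleOfQuotients`). The injective hull is `E / K`, for an injective object
`E` that contains `N` and a maximal subobject `K` that meets `N` trivially (`exists_injectiveHull`).

Conversely, let `H` be any module of quotients of `M`. Testing on the projective generators shows
that `Φ : M ⟶ H` factors through an embedding of `M / M_τ` with torsion cokernel, and that morphisms
from members of the Gabriel filter of a generator extend to the generator
(`ModuleOfQuotients.isClosedOn`). An object with the latter property is closed, because it coincides
with its closed envelope (`IsClosedOn.isClosed`). Thus each morphism from `M` to a closed object factors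
uniquely through `Φ`.

A derivation `D` on `M` is not a morphism of `A`, but `x ↦ x + D x ε` is one, from `M` to the module
of dual numbers `M[ε]`, an extension of `M` by `M` (`dualNumbers`); derivations on `M` are the sections
of `M[ε] ⟶ M`. As an extension of closed objects, `H[ε]` is closed, so that
`x ↦ Φ x + Φ (D x) ε` extends uniquely along `Φ` to a morphism `H ⟶ H[ε]`. By uniqueness, it is a
section of `H[ε] ⟶ H`, that is, a derivation on `H`.
-/

namespace HereditaryTorsionTheory

variable {A : Type u} [Category.{v} A] [Abelian A] (τ : HereditaryTorsionTheory A)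

/-! ### Torsion and torsion free objects -/

theorem torsion_iff {X : A} :
    τ.torsion X ↔ ∀ Y : A, τ.torsionFree Y → ∀ f : X ⟶ Y, f = 0 := by
  refine ⟨fun hX Y hY f => τ.hom_eq_zero hX hY f, fun h => ?_⟩
  obtain ⟨T, F, i, p, w, hS, hT, hF⟩ := τ.exists_shortExact X
  have := τ.torsion_iso
  have : Mono i := hS.mono_f
  have : Epi i := hS.exact.epi_f (h F hF p)
  have : IsIso i := isIso_of_mono_of_epi i
  exact τ.torsion.prop_of_iso (asIso i) hT

theorem torsionFree_iff {Y : A} :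
    τ.torsionFree Y ↔ ∀ X : A, τ.torsion X → ∀ f : X ⟶ Y, f = 0 := by
  refine ⟨fun hY X hX f => τ.hom_eq_zero hX hY f, fun h => ?_⟩
  obtain ⟨T, F, i, p, w, hS, hT, hF⟩ := τ.exists_shortExact Y
  have := τ.torsionFree_iso
  have : Epi p := hS.epi_g
  have : Mono p := hS.exact.mono_g (h T hT i)
  have : IsIso p := isIso_of_mono_of_epi p
  exact τ.torsionFree.prop_of_iso (asIso p).symm hF

theorem torsion_of_mono {X Y : A} (f : X ⟶ Y) [Mono f] (hY : τ.torsion Y) : τ.torsion X :=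
  have := τ.hereditary
  τ.torsion.prop_of_mono f hY

theorem torsion_of_epi {X Y : A} (f : X ⟶ Y) [Epi f] (hX : τ.torsion X) : τ.torsion Y :=
  τ.torsion_iff.2 fun Z hZ g => by
    rw [← cancel_epi f, comp_zero]
    exact τ.hom_eq_zero hX hZ _

theorem torsionFree_of_mono {X Y : A} (f : X ⟶ Y) [Mono f] (hY : τ.torsionFree Y) :
    τ.torsionFree X :=
  τ.torsionFree_iff.2 fun Z hZ g => by
    rw [← cancel_mono f, zero_comp]
    exact τ.hom_eq_zero hZ hY _

/-- Torsion free objects are closed under extensions. -/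
theorem torsionFree_of_extension {X Y Z : A} (i : X ⟶ Y) (p : Y ⟶ Z) (hX : τ.torsionFree X)
    (hZ : τ.torsionFree Z) (h : ∀ {W : A} (g : W ⟶ Y), g ≫ p = 0 → ∃ g' : W ⟶ X, g' ≫ i = g) :
    τ.torsionFree Y :=
  τ.torsionFree_iff.2 fun W hW g => by
    obtain ⟨g', rfl⟩ := h g (τ.hom_eq_zero hW hZ _)
    rw [τ.hom_eq_zero hW hX g', zero_comp]

theorem torsion_biprod {X Y : A} (hX : τ.torsion X) (hY : τ.torsion Y) : τ.torsion (X ⊞ Y) :=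
  τ.torsion_iff.2 fun Z hZ f => by
    ext
    · rw [τ.hom_eq_zero hX hZ (biprod.inl ≫ f), comp_zero]
    · rw [τ.hom_eq_zero hY hZ (biprod.inr ≫ f), comp_zero]

theorem torsionFree_torsionFreeQuotient (M : A) : τ.torsionFree (τ.torsionFreeQuotient M) := by
  obtain ⟨T, F, i, p, w, hS, hT, hF⟩ := τ.exists_shortExact M
  have := τ.torsion_iso
  have : Mono i := hS.mono_f
  have : Epi p := hS.epi_g
  have hle : Subobject.mk i ≤ τ.torsionSubobject M := (τ.torsionSubobject_isGreatest M).2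
    (τ.torsion.prop_of_iso (Subobject.underlyingIso i).symm hT)
  have hi : i ≫ τ.toTorsionFreeQuotient M = 0 := by
    have h0 : (τ.torsionSubobject M).arrow ≫ τ.toTorsionFreeQuotient M = 0 :=
      cokernel.condition _
    rw [← Subobject.underlyingIso_arrow i, ← Subobject.ofLE_arrow hle, Category.assoc,
      Category.assoc, h0, comp_zero, comp_zero]
  -- The map `M / M_τ ⟶ F` induced by `p` is a split monomorphism.
  let q : τ.torsionFreeQuotient M ⟶ F := cokernel.desc _ p
    (τ.hom_eq_zero (τ.torsionSubobject_isGreatest M).1 hF _)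
  have hq : τ.toTorsionFreeQuotient M ≫ q = p := cokernel.π_desc _ _ _
  obtain ⟨r, hr⟩ : ∃ r, p ≫ r = τ.toTorsionFreeQuotient M :=
    ⟨hS.gIsCokernel.desc (CokernelCofork.ofπ _ hi),
      hS.gIsCokernel.fac (CokernelCofork.ofπ _ hi) WalkingParallelPair.one⟩
  have hqr : q ≫ r = 𝟙 _ := by
    have : Epi (τ.toTorsionFreeQuotient M) := inferInstanceAs (Epi (cokernel.π _))
    rw [← cancel_epi (τ.toTorsionFreeQuotient M), ← Category.assoc, hq, hr, Category.comp_id]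
  have : Mono q := mono_of_mono_fac (hqr)
  exact τ.torsionFree_of_mono q hF

instance (M : A) : Epi (τ.toTorsionFreeQuotient M) :=
  inferInstanceAs (Epi (cokernel.π _))

/-! ### Morphisms with torsion cokernel -/

/-- A morphism has torsion cokernel if and only if it is an epimorphism as far as maps to torsion
free objects are concerned. -/
theorem torsion_cokernel_iff {X Y : A} (m : X ⟶ Y) :
    τ.torsion (cokernel m) ↔ ∀ Z : A, τ.torsionFree Z → ∀ g : Y ⟶ Z, m ≫ g = 0 → g = 0 := by
  refine ⟨fun h Z hZ g hg => ?_, fun h => τ.torsion_iff.2 fun Z hZ f => ?_⟩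
  · rw [← cokernel.π_desc m g hg, τ.hom_eq_zero h hZ (cokernel.desc m g hg), comp_zero]
  · rw [← cancel_epi (cokernel.π m), comp_zero]
    exact h Z hZ _ (by simp)

variable {τ} in
theorem torsionFree_hom_ext {X Y Z : A} {m : X ⟶ Y} (hm : τ.torsion (cokernel m))
    (hZ : τ.torsionFree Z) {f g : Y ⟶ Z} (h : m ≫ f = m ≫ g) : f = g := by
  rw [← sub_eq_zero]
  exact (τ.torsion_cokernel_iff m).1 hm Z hZ _ (by rw [Preadditive.comp_sub, h, sub_self])

theorem torsion_cokernel_comp {X Y Z : A} {m : X ⟶ Y} {n : Y ⟶ Z} (hm : τ.torsion (cokernel m))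
    (hn : τ.torsion (cokernel n)) : τ.torsion (cokernel (m ≫ n)) :=
  (τ.torsion_cokernel_iff _).2 fun W hW g hg =>
    (τ.torsion_cokernel_iff n).1 hn W hW g
      ((τ.torsion_cokernel_iff m).1 hm W hW _ (by rw [← Category.assoc, hg]))

/-- If `j` contains the kernel of a morphism to a torsion object, then `j` has torsion cokernel. -/
theorem torsion_cokernel_of_kernel_le {X Y T : A} (j : X ⟶ Y) (g : Y ⟶ T) (hT : τ.torsion T)
    (h : ∀ {W : A} (x : W ⟶ Y), x ≫ g = 0 → ∃ y : W ⟶ X, y ≫ j = x) : τ.torsion (cokernel j) := by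
  have hk : τ.torsion (cokernel (kernel.ι g)) :=
    τ.torsion_of_mono (Abelian.factorThruCoimage g) hT
  refine (τ.torsion_cokernel_iff j).2 fun Z hZ f hf => ?_
  obtain ⟨y, hy⟩ := h (kernel.ι g) (kernel.condition g)
  exact (τ.torsion_cokernel_iff _).1 hk Z hZ f (by rw [← hy, Category.assoc, hf, comp_zero])

theorem kernelSubobject_mem_gabrielFilter {X T : A} (g : X ⟶ T) (hT : τ.torsion T) :
    kernelSubobject g ∈ τ.gabrielFilter X :=
  τ.torsion_cokernel_of_kernel_le _ g hT fun x hx =>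
    ⟨factorThruKernelSubobject g x hx, factorThruKernelSubobject_comp_arrow g x hx⟩

theorem mk_mem_gabrielFilter {X Y : A} (m : X ⟶ Y) [Mono m] (hm : τ.torsion (cokernel m)) :
    Subobject.mk m ∈ τ.gabrielFilter Y :=
  (τ.torsion_cokernel_iff _).2 fun Z hZ g hg => (τ.torsion_cokernel_iff m).1 hm Z hZ g (by
    rw [← Subobject.underlyingIso_arrow m, Category.assoc, hg, comp_zero])

/-- The inverse image of a monomorphism `j` with torsion cokernel belongs to the Gabriel filter. -/
theorem exists_preimage {X Y Z : A} (j : X ⟶ Y) [Mono j] (hj : τ.torsion (cokernel j))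
    (x : Z ⟶ Y) : ∃ (I : τ.gabrielFilter Z) (f : (I.1 : A) ⟶ X), f ≫ j = I.1.arrow ≫ x :=
  ⟨⟨_, τ.kernelSubobject_mem_gabrielFilter (x ≫ cokernel.π j) hj⟩,
    Abelian.monoLift j ((kernelSubobject (x ≫ cokernel.π j)).arrow ≫ x) (by
      rw [Category.assoc, kernelSubobject_arrow_comp]), Abelian.monoLift_comp _ _ _⟩

instance (X : A) : Nonempty (τ.gabrielFilter X)ᵒᵈ :=
  ⟨OrderDual.toDual ⟨⊤, τ.top_mem_gabrielFilter X⟩⟩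

/-- The Gabriel filter is directed downwards: `X / (I ∩ J)` embeds into `X / I ⊞ X / J`. -/
theorem exists_le_le {X : A} (I J : τ.gabrielFilter X) :
    ∃ K : τ.gabrielFilter X, K.1 ≤ I.1 ∧ K.1 ≤ J.1 := by
  let g := biprod.lift (cokernel.π I.1.arrow) (cokernel.π J.1.arrow)
  have h : (kernelSubobject g).arrow ≫ g = 0 := kernelSubobject_arrow_comp g
  refine ⟨⟨kernelSubobject g, τ.kernelSubobject_mem_gabrielFilter _
    (τ.torsion_biprod I.2 J.2)⟩, ?_, ?_⟩
  · refine Subobject.le_of_comm (Abelian.monoLift I.1.arrow _ ?_) (Abelian.monoLift_comp _ _ _)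
    rw [← biprod.lift_fst (cokernel.π I.1.arrow) (cokernel.π J.1.arrow), ← Category.assoc, h,
      zero_comp]
  · refine Subobject.le_of_comm (Abelian.monoLift J.1.arrow _ ?_) (Abelian.monoLift_comp _ _ _)
    rw [← biprod.lift_snd (cokernel.π I.1.arrow) (cokernel.π J.1.arrow), ← Category.assoc, h,
      zero_comp]

instance (X : A) : IsDirectedOrder (τ.gabrielFilter X)ᵒᵈ where
  directed I J :=
    let ⟨K, hI, hJ⟩ := τ.exists_le_le (OrderDual.ofDual I) (OrderDual.ofDual J)
    ⟨OrderDual.toDual K, hI, hJ⟩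

theorem torsion_cokernel_ofLE {X : A} {I J : Subobject X} (h : J ≤ I)
    (hJ : τ.torsion (cokernel J.arrow)) : τ.torsion (cokernel (Subobject.ofLE J I h)) :=
  τ.torsion_cokernel_of_kernel_le _ (I.arrow ≫ cokernel.π J.arrow) hJ fun x hx =>
    ⟨Abelian.monoLift J.arrow (x ≫ I.arrow) (by rw [Category.assoc, hx]), by
      rw [← cancel_mono I.arrow, Category.assoc, Subobject.ofLE_arrow, Abelian.monoLift_comp]⟩

/-! ### Germs -/

theorem exists_germ {X N : A} (z : τ.LocalSections X N) :
    ∃ (I : τ.gabrielFilter X) (f : (I.1 : A) ⟶ N), τ.germ I f = z := by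
  classical
  exact AddCommGroup.DirectLimit.induction_on (C := fun z => ∃ (I : τ.gabrielFilter X)
    (f : (I.1 : A) ⟶ N), τ.germ I f = z) z fun I f => ⟨OrderDual.ofDual I, f, rfl⟩

theorem germ_restrict {X N : A} {I J : τ.gabrielFilter X} (h : J.1 ≤ I.1) (f : (I.1 : A) ⟶ N) :
    τ.germ J (Subobject.ofLE J.1 I.1 h ≫ f) = τ.germ I f := by
  classical
  exact AddCommGroup.DirectLimit.of_f (i := OrderDual.toDual I) (j := OrderDual.toDual J)
    (f := τ.restriction X N) h f

/-- The transition maps of the colimit are injective if the target is torsion free, because `I / J` is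
torsion for `J ⊆ I` in the Gabriel filter. -/
theorem germ_eq_zero_iff {X N : A} (hN : τ.torsionFree N) (I : τ.gabrielFilter X)
    (f : (I.1 : A) ⟶ N) : τ.germ I f = 0 ↔ f = 0 := by
  classical
  refine ⟨fun h => ?_, fun h => by rw [h, map_zero]⟩
  have : DirectedSystem (fun I : (τ.gabrielFilter X)ᵒᵈ => (((OrderDual.ofDual I).1 : A) ⟶ N))
      fun i j h => τ.restriction X N i j h :=
    { map_self := fun I f => by
        change Subobject.ofLE _ _ _ ≫ f = f
        rw [Subobject.ofLE_refl, Category.id_comp]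
      map_map := fun I J K hIJ hJK f => by
        exact (Category.assoc _ _ _).symm.trans
          (congrArg (· ≫ f) (Subobject.ofLE_comp_ofLE _ _ _ hJK hIJ)) }
  obtain ⟨J, hJ, h0⟩ := AddCommGroup.DirectLimit.of.zero_exact (f := τ.restriction X N)
    (OrderDual.toDual I) f h
  exact (τ.torsion_cokernel_iff _).1 (τ.torsion_cokernel_ofLE hJ (OrderDual.ofDual J).2) N hN f h0

theorem zeta_eq_zero_iff {X N : A} (hN : τ.torsionFree N) (f : X ⟶ N) :
    τ.zeta f = 0 ↔ f = 0 := by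
  rw [zeta, τ.germ_eq_zero_iff hN]
  exact ⟨fun h => by rwa [← cancel_epi (⊤ : Subobject X).arrow, comp_zero],
    fun h => by rw [h, comp_zero]⟩

end HereditaryTorsionTheory

/-! ### Injective hulls -/

section InjectiveHull

variable {A : Type u} [Category.{v} A] [Abelian A]

/-- Let `N` be a subobject of `E`. If `N` embeds into each term of a filtered system of quotients of
`E`, then it embeds into the colimit of the system: this is axiom AB5. -/
theorem mono_comp_colimit {J : Type v} [SmallCategory J] [IsFiltered J]
    [IsGrothendieckAbelian.{v} A] {F : J ⥤ A} {N E : A} (n : N ⟶ E)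
    (p : (Functor.const J).obj E ⟶ F) (hp : ∀ j, Mono (n ≫ p.app j)) :
    ∃ (Q : A) (q : E ⟶ Q), Mono (n ≫ q) ∧ ∀ j, ∃ t, p.app j ≫ t = q := by
  have hc : IsConnected J := IsFiltered.isConnected J
  let q : E ⟶ colimit F := (isColimitConstCocone J E).desc (Cocone.mk _ (p ≫ (colimit.cocone F).ι))
  have hq : ∀ j, p.app j ≫ colimit.ι F j = q := fun j => by
    exact ((Category.id_comp _).symm.trans
      ((isColimitConstCocone J E).fac (Cocone.mk _ (p ≫ (colimit.cocone F).ι)) j)).symm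
  let α := (Functor.const J).map n ≫ p
  have : ∀ j, Mono (α.app j) := hp
  have hα : Mono α := NatTrans.mono_of_mono_app α
  refine ⟨colimit F, q, ?_, fun j => ⟨colimit.ι F j, hq j⟩⟩
  exact colim.map_mono' α (isColimitConstCocone J N) (colimit.isColimit F) (n ≫ q)
    fun j => (Category.id_comp _).trans (by rw [← hq j]; exact (Category.assoc _ _ _).symm)

/-- The quotients of `E` by an increasing family of subobjects, as a functor. -/
@[simps]
noncomputable def quotientFunctor {E : A} {J : Type w} [Preorder J] (s : J →o Subobject E) :
    J ⥤ A where
  obj j := cokernel (s j).arrow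
  map {j k} f := cokernel.desc _ (cokernel.π (s k).arrow) (by
    rw [← Subobject.ofLE_arrow (s.monotone (leOfHom f)), Category.assoc, cokernel.condition,
      comp_zero])

/-- The projections of `E` onto its quotients by an increasing family of subobjects. -/
@[simps]
noncomputable def toQuotientFunctor {E : A} {J : Type w} [Preorder J] (s : J →o Subobject E) :
    (Functor.const J).obj E ⟶ quotientFunctor s where
  app j := cokernel.π (s j).arrow
  naturality _ _ _ := (Category.id_comp _).trans (cokernel.π_desc _ _ _).symm

/-- A directed family of subobjects of `E` that meet `N` trivially has an upper bound with this
property. -/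
theorem exists_upperBound_mono_comp_cokernel [IsGrothendieckAbelian.{v} A] {N E : A} (n : N ⟶ E)
    {J : Type v} [Preorder J] [IsDirectedOrder J] [Nonempty J] (s : J →o Subobject E)
    (hs : ∀ j, Mono (n ≫ cokernel.π (s j).arrow)) :
    ∃ K : Subobject E, Mono (n ≫ cokernel.π K.arrow) ∧ ∀ j, s j ≤ K := by
  -- The bound is the kernel of the map from `E` to the colimit of its quotients.
  obtain ⟨Q, q, hq, h⟩ := mono_comp_colimit n (toQuotientFunctor s) hs
  refine ⟨kernelSubobject q, ?_, fun j => le_kernelSubobject _ _ ?_⟩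
  · have h : (n ≫ cokernel.π (kernelSubobject q).arrow) ≫
        cokernel.desc _ q (kernelSubobject_arrow_comp q) = n ≫ q := by simp
    exact mono_of_mono_fac h
  · obtain ⟨t, ht⟩ := h j
    rw [← ht]
    exact (cokernel.condition_assoc (s j).arrow t).trans zero_comp

/-- Among the subobjects `K` of `E` that meet `N` trivially, there is a maximal one. -/
theorem exists_maximal_mono_comp_cokernel [IsGrothendieckAbelian.{v} A] {N E : A} (n : N ⟶ E)
    [Mono n] :
    ∃ K : Subobject E, Maximal (fun K : Subobject E => Mono (n ≫ cokernel.π K.arrow)) K := by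
  refine (zorn_le_nonempty₀ {K : Subobject E | Mono (n ≫ cokernel.π K.arrow)} ?_ ⊥ ?_).imp
    fun K hK => hK.2
  · intro c hc hchain y hy
    -- The category is well-powered, so that the chain can be indexed by a type in `Type v`.
    let e := (equivShrink.{v} c).symm
    let _ : Preorder (Shrink.{v} c) := Preorder.lift e
    have : Nonempty (Shrink.{v} c) := ⟨e.symm ⟨y, hy⟩⟩
    have : IsDirectedOrder (Shrink.{v} c) := ⟨fun i j => by
      rcases hchain.total (e i).2 (e j).2 with h | h
      · exact ⟨j, h, le_rfl⟩
      · exact ⟨i, le_rfl, h⟩⟩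
    obtain ⟨K, hK, h⟩ := exists_upperBound_mono_comp_cokernel n
      (⟨fun j => (e j).1, fun _ _ h => h⟩ : Shrink.{v} c →o Subobject E) fun j => hc (e j).2
    exact ⟨K, hK, fun z hz => (congrArg Subtype.val (e.apply_symm_apply ⟨z, hz⟩)).ge.trans
      (h (e.symm ⟨z, hz⟩))⟩
  · have : Mono (cokernel.π (⊥ : Subobject E).arrow) := by
      refine Preadditive.mono_of_cancel_zero _ fun {W} g hg => ?_
      rw [← Abelian.monoLift_comp _ g hg]
      exact (congrArg _ Subobject.bot_arrow).trans comp_zero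
    exact mono_comp _ _

/-- If `K` is maximal among the subobjects of `E` that meet `N` trivially, then `E / K` is an
essential extension of `N`. -/
theorem mono_of_maximal_mono_comp_cokernel {N E Z : A} {n : N ⟶ E} {K : Subobject E}
    (hK : Maximal (fun K : Subobject E => Mono (n ≫ cokernel.π K.arrow)) K)
    (f : cokernel K.arrow ⟶ Z) [Mono ((n ≫ cokernel.π K.arrow) ≫ f)] : Mono f := by
  let q := cokernel.π K.arrow ≫ f
  have hle : K ≤ kernelSubobject q := le_kernelSubobject _ _ (by
    rw [← Category.assoc, cokernel.condition, zero_comp])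
  have hm : Mono (n ≫ cokernel.π (kernelSubobject q).arrow) := by
    have h : (n ≫ cokernel.π (kernelSubobject q).arrow) ≫
        cokernel.desc _ q (kernelSubobject_arrow_comp q) = (n ≫ cokernel.π K.arrow) ≫ f := by
      simp [q]
    exact mono_of_mono_fac h
  have hge : kernelSubobject q ≤ K := hK.2 hm hle
  refine Preadditive.mono_of_cancel_zero _ fun {W} g hg => ?_
  -- Lift `g` to `E` after a base change.
  have hp : pullback.snd g (cokernel.π K.arrow) ≫ q = 0 := by
    rw [← Category.assoc, ← pullback.condition, Category.assoc, hg, comp_zero]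
  have : Epi (pullback.fst g (cokernel.π K.arrow)) := inferInstance
  rw [← cancel_epi (pullback.fst g (cokernel.π K.arrow)), comp_zero, pullback.condition,
    ← factorThruKernelSubobject_comp_arrow q _ hp, ← Subobject.ofLE_arrow hge, Category.assoc,
    Category.assoc, cokernel.condition, comp_zero, comp_zero]

/-- Two subobjects meet trivially: this is symmetric. -/
theorem mono_comp_cokernel_symm {N K E : A} (n : N ⟶ E) (k : K ⟶ E) [Mono n] [Mono k]
    [h : Mono (n ≫ cokernel.π k)] : Mono (k ≫ cokernel.π n) := by
  refine Preadditive.mono_of_cancel_zero _ fun {W} g hg => ?_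
  let y := Abelian.monoLift n (g ≫ k) (by simpa using hg)
  have hy : y ≫ n = g ≫ k := Abelian.monoLift_comp _ _ _
  have : y = 0 := by
    rw [← cancel_mono (n ≫ cokernel.π k), ← Category.assoc, hy]
    simp
  rw [← cancel_mono k, ← hy, this, zero_comp, zero_comp]

/-- In a Grothendieck category, every object embeds into an injective object as an essential
subobject. -/
theorem exists_injectiveHull [IsGrothendieckAbelian.{v} A] (N : A) :
    ∃ (Q : A) (j : N ⟶ Q), Injective Q ∧ Mono j ∧
      ∀ {Z : A} (f : Q ⟶ Z), Mono (j ≫ f) → Mono f := by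
  let E := Injective.under N
  let n : N ⟶ E := Injective.ι N
  obtain ⟨K, hK⟩ := exists_maximal_mono_comp_cokernel n
  have hnK : Mono (n ≫ cokernel.π K.arrow) := hK.1
  refine ⟨cokernel K.arrow, n ≫ cokernel.π K.arrow, ?_, hK.1,
    fun f hf => mono_of_maximal_mono_comp_cokernel hK f⟩
  -- A complement of `K` in `E` shows that `K`, hence also `E / K`, is a retract of `E`.
  obtain ⟨L, hL⟩ := exists_maximal_mono_comp_cokernel K.arrow
  have hKL : Mono (K.arrow ≫ cokernel.π L.arrow) := hL.1
  let g : cokernel L.arrow ⟶ E :=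
    Injective.factorThru K.arrow (K.arrow ≫ cokernel.π L.arrow)
  have hg : (K.arrow ≫ cokernel.π L.arrow) ≫ g = K.arrow := Injective.comp_factorThru _ _
  have hgm : Mono ((K.arrow ≫ cokernel.π L.arrow) ≫ g) := by rw [hg]; infer_instance
  have : Mono g := mono_of_maximal_mono_comp_cokernel hL g
  -- The image of `g` is an essential extension of `K` in `E`, so it still meets `N` trivially.
  have h1 : Mono (g ≫ cokernel.π n) := by
    have : Mono ((K.arrow ≫ cokernel.π L.arrow) ≫ g ≫ cokernel.π n) := by
      rw [← Category.assoc, hg]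
      exact mono_comp_cokernel_symm n K.arrow
    exact mono_of_maximal_mono_comp_cokernel hL _
  have h2 : Mono (n ≫ cokernel.π g) := mono_comp_cokernel_symm g n
  have h3 : Subobject.mk g ≤ K := by
    refine hK.2 ?_ (Subobject.le_mk_of_comm _ hg)
    have : (n ≫ cokernel.π (Subobject.mk g).arrow) ≫ cokernel.desc _ (cokernel.π g) (by
        rw [← Subobject.underlyingIso_hom_comp_eq_mk, Category.assoc, cokernel.condition,
          comp_zero]) = n ≫ cokernel.π g := by simp
    exact mono_of_mono_fac this
  let r : cokernel L.arrow ⟶ K := (Subobject.underlyingIso g).inv ≫ Subobject.ofLE _ _ h3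
  have hr : r ≫ K.arrow = g := by simp [r]
  let t : E ⟶ K := cokernel.π L.arrow ≫ r
  have ht : K.arrow ≫ t = 𝟙 _ := by
    rw [← cancel_mono K.arrow, Category.assoc, Category.assoc, hr, ← Category.assoc, hg,
      Category.id_comp]
  let s : cokernel K.arrow ⟶ E := cokernel.desc _ (𝟙 E - t ≫ K.arrow) (by
    rw [Preadditive.comp_sub, ← Category.assoc, ht]; simp)
  have hs : s ≫ cokernel.π K.arrow = 𝟙 _ := by
    rw [← cancel_epi (cokernel.π K.arrow)]
    simp [s, Preadditive.sub_comp]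
  exact Retract.injective (Y := E) ⟨s, cokernel.π K.arrow, hs⟩

end InjectiveHull

namespace HereditaryTorsionTheory

variable {A : Type u} [Category.{v} A] [Abelian A] (τ : HereditaryTorsionTheory A)

/-! ### Closed objects -/

/-- An object `K` is `τ`-closed if it is torsion free and morphisms to `K` extend along
monomorphisms with torsion cokernel. -/
structure IsClosed (K : A) : Prop where
  torsionFree : τ.torsionFree K
  exists_extension : ∀ {X Y : A} (m : X ⟶ Y) [Mono m], τ.torsion (cokernel m) →
    ∀ u : X ⟶ K, ∃ v : Y ⟶ K, m ≫ v = u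

/-- An object `K` is `τ`-closed on a family `P` of objects if it is torsion free and each morphism
`I ⟶ K` with `I ∈ ℒ_{P i}` extends to `P i`. -/
structure IsClosedOn {ι : Type w} (P : ι → A) (K : A) : Prop where
  torsionFree : τ.torsionFree K
  exists_extension : ∀ (i : ι) (I : τ.gabrielFilter (P i)) (u : (I.1 : A) ⟶ K),
    ∃ v : P i ⟶ K, I.1.arrow ≫ v = u

/-- Every torsion free object `N` embeds into a closed object with torsion cokernel: if `Q` is an
injective hull of `N`, which is torsion free, take the inverse image in `Q` of the torsion subobject
of `Q / N`. -/
theorem exists_closedEnvelope [IsGrothendieckAbelian.{v} A] {N : A} (hN : τ.torsionFree N) :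
    ∃ (H : A) (j : N ⟶ H), Mono j ∧ τ.torsion (cokernel j) ∧ τ.IsClosed H := by
  obtain ⟨Q, n, hQ, hn, hess⟩ := exists_injectiveHull N
  have hQtf : τ.torsionFree Q := by
    have : Mono (τ.toTorsionFreeQuotient Q) := by
      -- The kernel of `N ⟶ Q / Q_τ` embeds into `Q_τ`, so it vanishes.
      refine hess _ (Preadditive.mono_of_kernel_zero ?_)
      let k := kernel.ι (n ≫ τ.toTorsionFreeQuotient Q)
      have hk : (k ≫ n) ≫ cokernel.π (τ.torsionSubobject Q).arrow = 0 :=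
        (Category.assoc _ _ _).trans (kernel.condition (n ≫ τ.toTorsionFreeQuotient Q))
      have : Mono (Abelian.monoLift (τ.torsionSubobject Q).arrow (k ≫ n) hk) :=
        mono_of_mono_fac (h := k ≫ n) (Abelian.monoLift_comp _ _ hk)
      exact τ.hom_eq_zero (τ.torsion_of_mono
        (Abelian.monoLift (τ.torsionSubobject Q).arrow (k ≫ n) hk)
        (τ.torsionSubobject_isGreatest Q).1) hN _
    exact τ.torsionFree_of_mono (τ.toTorsionFreeQuotient Q)
      (τ.torsionFree_torsionFreeQuotient Q)
  let q : Q ⟶ τ.torsionFreeQuotient (cokernel n) :=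
    cokernel.π n ≫ τ.toTorsionFreeQuotient (cokernel n)
  let j : N ⟶ kernel q := kernel.lift q n (by simp [q])
  have hj : j ≫ kernel.ι q = n := kernel.lift_ι _ _ _
  refine ⟨kernel q, j, mono_of_mono_fac hj, ?_, τ.torsionFree_of_mono (kernel.ι q) hQtf, ?_⟩
  · have h0 : (kernel.ι q ≫ cokernel.π n) ≫
        cokernel.π (τ.torsionSubobject (cokernel n)).arrow = 0 :=
      (Category.assoc _ _ _).trans (kernel.condition q)
    let g := Abelian.monoLift (τ.torsionSubobject (cokernel n)).arrow _ h0
    have hg : g ≫ (τ.torsionSubobject (cokernel n)).arrow = kernel.ι q ≫ cokernel.π n :=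
      Abelian.monoLift_comp _ _ _
    refine τ.torsion_cokernel_of_kernel_le j g (τ.torsionSubobject_isGreatest _).1 fun x hx => ?_
    have hx' : (x ≫ kernel.ι q) ≫ cokernel.π n = 0 := by
      rw [Category.assoc, ← hg, ← Category.assoc, hx, zero_comp]
    refine ⟨Abelian.monoLift n _ hx', ?_⟩
    rw [← cancel_mono (kernel.ι q), Category.assoc, hj, Abelian.monoLift_comp]
  · intro X Y m _ hm u
    let v : Y ⟶ Q := Injective.factorThru (u ≫ kernel.ι q) m
    have hv : m ≫ v = u ≫ kernel.ι q := Injective.comp_factorThru _ _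
    have hvq : v ≫ q = 0 := (τ.torsion_cokernel_iff m).1 hm _
      (τ.torsionFree_torsionFreeQuotient _) _ (by
        rw [← Category.assoc, hv, Category.assoc, kernel.condition, comp_zero])
    exact ⟨kernel.lift q v hvq, by rw [← cancel_mono (kernel.ι q)]; simp [hv]⟩

/-- It suffices to test closedness on a separating family: an object that is closed on the family
coincides with its closed envelope. -/
theorem IsClosedOn.isClosed [IsGrothendieckAbelian.{v} A] {τ : HereditaryTorsionTheory A}
    {ι : Type w} {P : ι → A} (hP : (ObjectProperty.ofObj P).IsSeparating) {K : A}
    (hK : τ.IsClosedOn P K) : τ.IsClosed K := by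
  obtain ⟨H, k, hk, hkt, hH⟩ := τ.exists_closedEnvelope hK.torsionFree
  have : Epi k := by
    refine Preadditive.epi_of_cancel_zero _ fun {W} g hg => hP _ _ ?_
    rintro _ ⟨i⟩ x
    obtain ⟨I, f, hf⟩ := τ.exists_preimage k hkt x
    obtain ⟨y, hy⟩ := hK.exists_extension i I f
    have : y ≫ k = x := torsionFree_hom_ext I.2 hH.torsionFree (by
      rw [← Category.assoc, hy, hf])
    rw [← this, Category.assoc, hg, comp_zero, comp_zero]
  have : IsIso k := isIso_of_mono_of_epi k
  refine ⟨hK.torsionFree, fun m _ hm u => ?_⟩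
  obtain ⟨v, hv⟩ := hH.exists_extension m hm (u ≫ k)
  exact ⟨v ≫ inv k, by rw [← Category.assoc, hv]; simp⟩

/-- Closedness on a family of projective objects passes to extensions. -/
theorem IsClosedOn.of_extension {τ : HereditaryTorsionTheory A} {ι : Type w} {P : ι → A}
    [∀ i, Projective (P i)] {X Y Z : A} (i : X ⟶ Y) (p : Y ⟶ Z) [Epi p]
    (hX : τ.IsClosedOn P X) (hZ : τ.IsClosedOn P Z)
    (h : ∀ {W : A} (g : W ⟶ Y), g ≫ p = 0 → ∃ g' : W ⟶ X, g' ≫ i = g) :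
    τ.IsClosedOn P Y where
  torsionFree := τ.torsionFree_of_extension i p hX.torsionFree hZ.torsionFree h
  exists_extension a I u := by
    obtain ⟨z, hz⟩ := hZ.exists_extension a I (u ≫ p)
    let y := Projective.factorThru z p
    have hy : y ≫ p = z := Projective.factorThru_comp _ _
    obtain ⟨g, hg⟩ := h (u - I.1.arrow ≫ y) (by
      rw [Preadditive.sub_comp, Category.assoc, hy, hz, sub_self])
    obtain ⟨x, hx⟩ := hX.exists_extension a I g
    exact ⟨y + x ≫ i, by rw [Preadditive.comp_add, ← Category.assoc, hx, hg]; abel⟩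

/-! ### Existence of modules of quotients -/

/-- Sections of a closed envelope `j : N ⟶ H` over `X` are germs of morphisms from `X` to `N`: a germ
extends uniquely to a section, and a section is determined by its restriction to the inverse
image of `N`. -/
noncomputable def sectionsOfIsClosed {N H : A} (j : N ⟶ H) (hH : τ.IsClosed H) (X : A) :
    τ.LocalSections X N →+ (X ⟶ H) := by
  classical
  exact AddCommGroup.DirectLimit.lift (fun I : (τ.gabrielFilter X)ᵒᵈ =>
      (((OrderDual.ofDual I).1 : A) ⟶ N)) (τ.restriction X N) _
    (fun I => AddMonoidHom.mk'
      (fun f => (hH.exists_extension _ (OrderDual.ofDual I).2 (f ≫ j)).choose) fun f g => by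
        refine torsionFree_hom_ext (OrderDual.ofDual I).2 hH.torsionFree ?_
        rw [Preadditive.comp_add, (hH.exists_extension _ (OrderDual.ofDual I).2 _).choose_spec,
          (hH.exists_extension _ (OrderDual.ofDual I).2 _).choose_spec,
          (hH.exists_extension _ (OrderDual.ofDual I).2 _).choose_spec, Preadditive.add_comp])
    fun I J h f => by
      refine torsionFree_hom_ext (OrderDual.ofDual J).2 hH.torsionFree ?_
      refine (hH.exists_extension _ (OrderDual.ofDual J).2 _).choose_spec.trans ?_
      have h1 := (hH.exists_extension _ (OrderDual.ofDual I).2 (f ≫ j)).choose_spec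
      refine Eq.trans ?_ (congrArg (· ≫ _) (Subobject.ofLE_arrow
        (X := (OrderDual.ofDual J).1) (Y := (OrderDual.ofDual I).1) h))
      refine Eq.trans ?_ (Category.assoc _ _ _).symm
      exact (Category.assoc _ _ _).trans (congrArg (_ ≫ ·) h1.symm)

/-- The section attached to a germ extends it. -/
theorem arrow_comp_sectionsOfIsClosed {N H : A} (j : N ⟶ H) (hH : τ.IsClosed H) {X : A}
    (I : τ.gabrielFilter X) (f : (I.1 : A) ⟶ N) :
    I.1.arrow ≫ τ.sectionsOfIsClosed j hH X (τ.germ I f) = f ≫ j := by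
  classical
  have : τ.sectionsOfIsClosed j hH X (τ.germ I f) =
      (hH.exists_extension _ I.2 (f ≫ j)).choose := by
    exact AddCommGroup.DirectLimit.lift_of _ _ _ _ _
  rw [this]
  exact (hH.exists_extension _ I.2 (f ≫ j)).choose_spec

theorem sectionsOfIsClosed_bijective {N H : A} (j : N ⟶ H) [Mono j]
    (hj : τ.torsion (cokernel j)) (hH : τ.IsClosed H) (X : A) :
    Function.Bijective (τ.sectionsOfIsClosed j hH X) := by
  refine ⟨(injective_iff_map_eq_zero _).2 fun z hz => ?_, fun x => ?_⟩
  · obtain ⟨I, f, rfl⟩ := τ.exists_germ z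
    have : f = 0 := by
      rw [← cancel_mono j, ← τ.arrow_comp_sectionsOfIsClosed j hH, hz, comp_zero, zero_comp]
    rw [this, map_zero]
  · obtain ⟨I, f, hf⟩ := τ.exists_preimage j hj x
    exact ⟨τ.germ I f, torsionFree_hom_ext I.2 hH.torsionFree
      ((τ.arrow_comp_sectionsOfIsClosed j hH I f).trans hf)⟩

/-- The closed envelope of `M / M_τ` is a module of quotients of `M`. -/
theorem nonempty_moduleOfQuotients [IsGrothendieckAbelian.{v} A] {ι : Type w} (P : ι → A) (M : A) :
    Nonempty (τ.ModuleOfQuotients P M) := by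
  obtain ⟨H, j, _, hj, hH⟩ := τ.exists_closedEnvelope (τ.torsionFree_torsionFreeQuotient M)
  let e (X : A) := AddEquiv.ofBijective _ (τ.sectionsOfIsClosed_bijective j hj hH X)
  have he {X : A} (x : X ⟶ H) (I : τ.gabrielFilter X) (f : (I.1 : A) ⟶ τ.torsionFreeQuotient M) :
      (e X).symm x = τ.germ I f ↔ I.1.arrow ≫ x = f ≫ j := by
    rw [AddEquiv.symm_apply_eq, ← τ.arrow_comp_sectionsOfIsClosed j hH I f]
    exact ⟨fun h => congrArg _ h, fun h => torsionFree_hom_ext I.2 hH.torsionFree h⟩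
  exact ⟨{
    obj := H
    unit := τ.toTorsionFreeQuotient M ≫ j
    sections := fun i => (e (P i)).symm
    sections_naturality := fun h I I' h' hh f x hx => by
      rw [he] at hx ⊢
      rw [← Category.assoc, ← hh, Category.assoc, hx, Category.assoc]
    sections_unit := fun i f => by
      rw [zeta, he]
      simp }⟩

/-! ### Every module of quotients is closed -/

namespace ModuleOfQuotients

variable {τ} {ι : Type w} {P : ι → A} {M : A} (H : τ.ModuleOfQuotients P M)

/-- `Φ_M` factors as `M ⟶ M / M_τ ↪ H_τ(M)`: on maps from the projective `P i`, its kernel is that of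
`M ⟶ M / M_τ`, because `ζ` is injective. -/
theorem exists_fac (hP : (ObjectProperty.ofObj P).IsSeparating) [∀ i, Projective (P i)] :
    ∃ j : τ.torsionFreeQuotient M ⟶ H.obj, Mono j ∧ τ.toTorsionFreeQuotient M ≫ j = H.unit := by
  have hiff : ∀ (i : ι) (f : P i ⟶ M), f ≫ H.unit = 0 ↔ f ≫ τ.toTorsionFreeQuotient M = 0 :=
    fun i f => by
      rw [← τ.zeta_eq_zero_iff (τ.torsionFree_torsionFreeQuotient M), ← H.sections_unit,
        map_eq_zero_iff _ (H.sections i).injective]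
  have h0 : (τ.torsionSubobject M).arrow ≫ H.unit = 0 := hP _ _ (by
    rintro _ ⟨i⟩ f
    rw [comp_zero, ← Category.assoc, hiff, Category.assoc]
    exact (congrArg (f ≫ ·) (cokernel.condition _)).trans comp_zero)
  let j : τ.torsionFreeQuotient M ⟶ H.obj := cokernel.desc _ H.unit h0
  have hj : τ.toTorsionFreeQuotient M ≫ j = H.unit := cokernel.π_desc _ _ _
  refine ⟨j, Preadditive.mono_of_cancel_zero _ fun {W} g hg => hP _ _ ?_, hj⟩
  rintro _ ⟨i⟩ h
  have hk : Projective.factorThru (h ≫ g) (τ.toTorsionFreeQuotient M) ≫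
      τ.toTorsionFreeQuotient M = h ≫ g := Projective.factorThru_comp _ _
  rw [comp_zero, ← hk, ← hiff, ← hj, ← Category.assoc, hk, Category.assoc, hg, comp_zero]

variable {j : τ.torsionFreeQuotient M ⟶ H.obj}

/-- If a section over `P i` corresponds to the germ of `f : I ⟶ M / M_τ`, then it extends `f`. -/
theorem arrow_comp_eq (hP : (ObjectProperty.ofObj P).IsSeparating) [∀ i, Projective (P i)]
    (hj : τ.toTorsionFreeQuotient M ≫ j = H.unit) {i : ι} {x : P i ⟶ H.obj}
    {I : τ.gabrielFilter (P i)} {f : (I.1 : A) ⟶ τ.torsionFreeQuotient M}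
    (h : H.sections i x = τ.germ I f) : I.1.arrow ≫ x = f ≫ j := by
  refine hP _ _ ?_
  rintro _ ⟨k⟩ y
  have hz : Projective.factorThru (y ≫ f) (τ.toTorsionFreeQuotient M) ≫
      τ.toTorsionFreeQuotient M = y ≫ f := Projective.factorThru_comp _ _
  have h1 := H.sections_naturality (y ≫ I.1.arrow) I ⟨⊤, τ.top_mem_gabrielFilter (P k)⟩
    ((⊤ : Subobject (P k)).arrow ≫ y) (Category.assoc _ _ _) f x h
  have h2 := H.sections_unit k (Projective.factorThru (y ≫ f) (τ.toTorsionFreeQuotient M))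
  rw [hz, zeta, ← Category.assoc, ← h1] at h2
  rw [← Category.assoc, ← Category.assoc, ← hz, Category.assoc _ _ j, hj,
    (H.sections k).injective h2]

theorem torsionFree_obj (hP : (ObjectProperty.ofObj P).IsSeparating) [∀ i, Projective (P i)] :
    τ.torsionFree H.obj := by
  obtain ⟨j, _, hj⟩ := H.exists_fac hP
  refine τ.torsionFree_iff.2 fun T hT t => hP _ _ ?_
  rintro _ ⟨i⟩ h
  rw [comp_zero]
  -- The section `h ≫ t` vanishes on the kernel of `h`, which belongs to the Gabriel filter.
  obtain ⟨J, g, hg⟩ := τ.exists_germ (H.sections i (h ≫ t))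
  obtain ⟨K, hK, hKJ⟩ := τ.exists_le_le ⟨_, τ.kernelSubobject_mem_gabrielFilter h hT⟩ J
  have hx := H.arrow_comp_eq hP hj hg.symm
  have h0 : Subobject.ofLE K.1 J.1 hKJ ≫ g = 0 := by
    rw [← cancel_mono j, Category.assoc, ← hx, ← Category.assoc, Subobject.ofLE_arrow,
      ← Subobject.ofLE_arrow hK, Category.assoc, kernelSubobject_arrow_comp_assoc, zero_comp,
      comp_zero, zero_comp]
  rw [← τ.germ_restrict hKJ, h0, map_zero] at hg
  exact (map_eq_zero_iff _ (H.sections i).injective).1 hg.symm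

theorem torsion_cokernel (hP : (ObjectProperty.ofObj P).IsSeparating) [∀ i, Projective (P i)]
    (hj : τ.toTorsionFreeQuotient M ≫ j = H.unit) : τ.torsion (cokernel j) := by
  refine (τ.torsion_cokernel_iff j).2 fun F hF f hf => hP _ _ ?_
  rintro _ ⟨i⟩ x
  obtain ⟨J, g, hg⟩ := τ.exists_germ (H.sections i x)
  have hx := H.arrow_comp_eq hP hj hg.symm
  rw [comp_zero]
  exact (τ.torsion_cokernel_iff _).1 J.2 F hF _ (by
    rw [← Category.assoc, hx, Category.assoc, hf, comp_zero])

/-- A morphism `u : I ⟶ H_τ(M)` with `I ∈ ℒ_{P i}` is a germ of morphisms to `M / M_τ` on the inverse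
image of `M / M_τ`; the section with this germ extends `u`. -/
theorem isClosedOn (hP : (ObjectProperty.ofObj P).IsSeparating) [∀ i, Projective (P i)] :
    τ.IsClosedOn P H.obj where
  torsionFree := H.torsionFree_obj hP
  exists_extension i I u := by
    obtain ⟨j, _, hj⟩ := H.exists_fac hP
    obtain ⟨J, f, hf⟩ := τ.exists_preimage j (H.torsion_cokernel hP hj) u
    let K : τ.gabrielFilter (P i) := ⟨_, τ.mk_mem_gabrielFilter (J.1.arrow ≫ I.1.arrow)
      (τ.torsion_cokernel_comp J.2 I.2)⟩
    let e := Subobject.underlyingIso (J.1.arrow ≫ I.1.arrow)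
    have he : e.inv ≫ K.1.arrow = J.1.arrow ≫ I.1.arrow := Subobject.underlyingIso_arrow _
    have hx := H.arrow_comp_eq hP hj
      ((H.sections i).apply_symm_apply (τ.germ K (e.hom ≫ f)))
    refine ⟨(H.sections i).symm (τ.germ K (e.hom ≫ f)),
      torsionFree_hom_ext J.2 (H.torsionFree_obj hP) ?_⟩
    refine (Category.assoc _ _ _).symm.trans ((congrArg (· ≫ _) he.symm).trans ?_)
    rw [Category.assoc, hx, ← hf, Category.assoc, Iso.inv_hom_id_assoc]

/-- Morphisms from `M` to a closed object extend to `H_τ(M)`. -/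
theorem exists_unit_comp_eq (hP : (ObjectProperty.ofObj P).IsSeparating) [∀ i, Projective (P i)]
    {K : A} (hK : τ.IsClosed K) (u : M ⟶ K) : ∃ v : H.obj ⟶ K, H.unit ≫ v = u := by
  obtain ⟨j, _, hj⟩ := H.exists_fac hP
  let u' : τ.torsionFreeQuotient M ⟶ K := cokernel.desc _ u
    (τ.hom_eq_zero (τ.torsionSubobject_isGreatest M).1 hK.torsionFree _)
  have hu' : τ.toTorsionFreeQuotient M ≫ u' = u := cokernel.π_desc _ _ _
  obtain ⟨v, hv⟩ := hK.exists_extension j (H.torsion_cokernel hP hj) u'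
  exact ⟨v, by rw [← hj, Category.assoc, hv, hu']⟩

/-- Morphisms from `H_τ(M)` to a torsion free object are determined on `M`. -/
theorem hom_ext (hP : (ObjectProperty.ofObj P).IsSeparating) [∀ i, Projective (P i)]
    {K : A} (hK : τ.torsionFree K) {v v' : H.obj ⟶ K} (h : H.unit ≫ v = H.unit ≫ v') : v = v' := by
  obtain ⟨j, _, hj⟩ := H.exists_fac hP
  refine torsionFree_hom_ext (H.torsion_cokernel hP hj) hK ?_
  rwa [← cancel_epi (τ.toTorsionFreeQuotient M), ← Category.assoc, ← Category.assoc, hj]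

end ModuleOfQuotients

end HereditaryTorsionTheory

/-! ### The Eilenberg-Moore category as a Grothendieck category with projective generators -/

section EilenbergMoore

variable {C : Type u} [Category.{v} C]

/-- Free modules on a separating family separate, as the forgetful functor is faithful. -/
theorem isSeparating_free (U : Monad C) {ι : Type w} {G : ι → C}
    (hG : (ObjectProperty.ofObj G).IsSeparating) :
    (ObjectProperty.ofObj fun i => U.free.obj (G i)).IsSeparating := fun X Y f g h => by
  ext
  refine hG _ _ ?_
  rintro _ ⟨i⟩ x
  exact (U.adj.homEquiv (G i) Y).symm.injective
    ((U.adj.homEquiv_naturality_right_symm x f).trans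
      ((h _ (ObjectProperty.ofObj_apply _ i) ((U.adj.homEquiv _ _).symm x)).trans
        (U.adj.homEquiv_naturality_right_symm x g).symm))

variable [Abelian C] (U : Monad C)

/-- The forgetful functor preserves epimorphisms, so its left adjoint preserves projectives. -/
theorem projective_free [PreservesFiniteLimits U.toFunctor] [PreservesFiniteColimits U.toFunctor]
    (X : C) [Projective X] : Projective (U.free.obj X) := by
  have : PreservesFiniteColimits U.forget := ⟨fun J _ _ => inferInstance⟩
  exact U.adj.map_projective X inferInstance

/-- The forgetful functor creates filtered colimits and finite limits, hence axiom AB5 passes to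
modules; the free module on a separator is a separator. -/
theorem isGrothendieckAbelian_algebra [IsGrothendieckAbelian.{v} C]
    [PreservesFiniteLimits U.toFunctor] [PreservesColimits U.toFunctor] :
    IsGrothendieckAbelian.{v} U.Algebra := by
  have : HasColimitsOfSize.{v, v} U.Algebra :=
    ⟨fun J _ => ⟨fun F => Monad.forget_creates_colimits_of_monad_preserves F⟩⟩
  have : HasFilteredColimitsOfSize.{v, v} U.Algebra := ⟨fun J _ _ => inferInstance⟩
  have : PreservesFiniteLimits U.forget := ⟨fun J _ _ => inferInstance⟩
  have : HasFiniteLimits U.Algebra := monadAlgebra_hasFiniteLimits U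
  have : ReflectsFiniteLimits U.forget := ⟨fun J _ _ => inferInstance⟩
  exact
    { ab5OfSize := ⟨fun J _ _ => HasExactColimitsOfShape.domain_of_functor J U.forget⟩
      hasSeparator := ⟨U.free.obj (separator C), by
        have h := isSeparating_free U (G := fun _ : Unit => separator C) (by
          intro X Y f g h
          exact (isSeparator_separator C) f g fun _ hG k => by
            obtain rfl := (ObjectProperty.singleton_iff _ _).1 hG
            exact h _ (ObjectProperty.ofObj_apply _ ()) k)
        intro X Y f g hfg
        refine h f g ?_
        rintro _ ⟨_⟩ k
        exact hfg _ (by simp) k⟩ }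

end EilenbergMoore

/-! ### Derivations as sections of the algebra of dual numbers -/

section DualNumbers

variable {C : Type u} [Category.{v} C] [Abelian C] {U : Monad C}
  {δ : U.toFunctor ⟶ U.toFunctor}

/-- A derivation annihilates the unit of the monad. -/
theorem IsMonadDerivation.η_app_comp (hδ : IsMonadDerivation U δ) (X : C) :
    U.η.app X ≫ δ.app X = 0 := by
  have hη {Y Z : C} (f : Y ⟶ Z) : U.η.app Y ≫ U.map f = f ≫ U.η.app Z := (U.η.naturality f).symm
  have h := congrArg (fun f => U.η.app X ≫ U.η.app (U.obj X) ≫ f) (hδ X)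
  have h1 : U.η.app X ≫ U.η.app (U.obj X) ≫ U.map (δ.app X) ≫ U.μ.app X =
      U.η.app X ≫ δ.app X := by
    rw [← Category.assoc (U.η.app (U.obj X)), hη, Category.assoc, Monad.left_unit]
    exact congrArg (_ ≫ ·) (Category.comp_id _)
  have h2 : U.η.app X ≫ U.η.app (U.obj X) ≫ δ.app (U.obj X) ≫ U.μ.app X =
      U.η.app X ≫ δ.app X := by
    rw [← Category.assoc, ← hη, Category.assoc, ← Category.assoc (U.map _), δ.naturality,
      Category.assoc, Monad.right_unit]
    exact congrArg (_ ≫ ·) (Category.comp_id _)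
  have h3 : U.η.app X ≫ U.η.app (U.obj X) ≫ U.μ.app X ≫ δ.app X = U.η.app X ≫ δ.app X := by
    rw [← Category.assoc (U.η.app (U.obj X)), Monad.left_unit]
    exact congrArg (_ ≫ ·) (Category.id_comp _)
  rw [Preadditive.add_comp, Preadditive.comp_add, Preadditive.comp_add, h1, h2, h3] at h
  simpa using h

variable [PreservesFiniteLimits U.toFunctor]

/-- The dual numbers `M[ε] = M ⊕ M ε` over a `U`-module `M`: the action is twisted by `δ`, in such
a way that `x ↦ x + D x ε` is a morphism of `U`-modules exactly if `D` is a `δ`-derivation. -/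
noncomputable def dualNumbers (hδ : IsMonadDerivation U δ) (M : U.Algebra) : U.Algebra where
  A := M.A ⊞ M.A
  a := biprod.lift (U.map biprod.fst ≫ M.a)
    (U.map biprod.snd ≫ M.a + δ.app _ ≫ U.map biprod.fst ≫ M.a)
  unit := by
    have hη {Z : C} (f : M.A ⊞ M.A ⟶ Z) : U.η.app _ ≫ U.map f = f ≫ U.η.app Z :=
      (U.η.naturality f).symm
    ext
    · rw [Category.assoc, biprod.lift_fst, ← Category.assoc, hη, Category.assoc, M.unit]
      simp
    · rw [Category.assoc, biprod.lift_snd, Preadditive.comp_add, ← Category.assoc, hη,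
        ← Category.assoc (U.η.app _) (δ.app _), hδ.η_app_comp, Category.assoc, M.unit]
      simp
  assoc := by
    have hμ {Z : C} (f : M.A ⊞ M.A ⟶ Z) :
        U.map (U.map f) ≫ U.μ.app Z = U.μ.app _ ≫ U.map f := U.μ.naturality f
    have h1 : U.map (U.map (biprod.fst : M.A ⊞ M.A ⟶ M.A)) ≫ U.map M.a ≫ M.a =
        U.μ.app _ ≫ U.map biprod.fst ≫ M.a := by
      rw [← M.assoc, ← Category.assoc, hμ, Category.assoc]
    have h2 : U.map (U.map (biprod.snd : M.A ⊞ M.A ⟶ M.A)) ≫ U.map M.a ≫ M.a =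
        U.μ.app _ ≫ U.map biprod.snd ≫ M.a := by
      rw [← M.assoc, ← Category.assoc, hμ, Category.assoc]
    ext
    · rw [Category.assoc, biprod.lift_fst, Category.assoc, biprod.lift_fst, ← Category.assoc,
        ← Category.assoc, ← U.map_comp, biprod.lift_fst, U.map_comp, Category.assoc,
        Category.assoc, h1]
    · -- The derivation property of `δ` accounts for the two terms that contain `δ`.
      have h3 := hδ (M.A ⊞ M.A) =≫ (U.map biprod.fst ≫ M.a)
      rw [Category.assoc, Category.assoc, Preadditive.add_comp] at h3
      have h5 : U.map (biprod.lift (U.map biprod.fst ≫ M.a)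
          (U.map biprod.snd ≫ M.a + δ.app (M.A ⊞ M.A) ≫ U.map biprod.fst ≫ M.a)) ≫
            δ.app _ ≫ U.map biprod.fst ≫ M.a =
              δ.app _ ≫ U.μ.app (M.A ⊞ M.A) ≫ U.map biprod.fst ≫ M.a := by
        rw [← Category.assoc, δ.naturality, Category.assoc, ← Category.assoc (U.map _),
          ← U.map_comp, biprod.lift_fst, U.map_comp, Category.assoc, h1]
      rw [Category.assoc, biprod.lift_snd, Category.assoc, biprod.lift_snd,
        Preadditive.comp_add, Preadditive.comp_add, ← h3, h5, ← Category.assoc (U.map _)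
        (U.map biprod.snd), ← U.map_comp, biprod.lift_snd, U.toFunctor.map_add,
        Preadditive.add_comp, U.map_comp, U.map_comp, U.map_comp, Category.assoc, h2,
        Category.assoc, Category.assoc, h1]
      exact (add_assoc _ _ _).symm

/-- The projection `M[ε] ⟶ M`, `ε ↦ 0`. -/
noncomputable def dualNumbersFst (hδ : IsMonadDerivation U δ) (M : U.Algebra) :
    dualNumbers hδ M ⟶ M where
  f := biprod.fst
  h := (biprod.lift_fst _ _).symm

/-- The coefficient of `ε`; this is not a morphism of `U`-modules. -/
noncomputable def dualNumbersSnd (hδ : IsMonadDerivation U δ) (M : U.Algebra) :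
    (dualNumbers hδ M).A ⟶ M.A :=
  biprod.snd

theorem dualNumbers_a_snd (hδ : IsMonadDerivation U δ) (M : U.Algebra) :
    (dualNumbers hδ M).a ≫ dualNumbersSnd hδ M = U.map (dualNumbersSnd hδ M) ≫ M.a +
      δ.app _ ≫ U.map (dualNumbersFst hδ M).f ≫ M.a :=
  biprod.lift_snd _ _

theorem dualNumbers_hom_ext {hδ : IsMonadDerivation U δ} {M : U.Algebra} {X : C}
    {f g : X ⟶ (dualNumbers hδ M).A}
    (h1 : f ≫ (dualNumbersFst hδ M).f = g ≫ (dualNumbersFst hδ M).f)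
    (h2 : f ≫ dualNumbersSnd hδ M = g ≫ dualNumbersSnd hδ M) : f = g :=
  biprod.hom_ext _ _ h1 h2

/-- The coefficient of `ε` in a morphism to `M[ε]` is a derivation along its constant
coefficient. -/
theorem comp_dualNumbersSnd (hδ : IsMonadDerivation U δ) {X M : U.Algebra}
    (g : X ⟶ dualNumbers hδ M) :
    U.map (g.f ≫ dualNumbersSnd hδ M) ≫ M.a + δ.app X.A ≫ X.a ≫ g.f ≫ (dualNumbersFst hδ M).f =
      X.a ≫ g.f ≫ dualNumbersSnd hδ M := by
  rw [← Category.assoc X.a g.f, ← Category.assoc X.a g.f, ← g.h, Category.assoc, Category.assoc,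
    dualNumbers_a_snd, ← (dualNumbersFst hδ M).h, Preadditive.comp_add, U.map_comp,
    ← Category.assoc (U.map g.f) (δ.app _), δ.naturality, Category.assoc, Category.assoc]

/-- A morphism `X ⟶ M[ε]` of `U`-modules, given by its constant coefficient `x` and a derivation
`y` along `x`. -/
noncomputable def dualNumbersLift (hδ : IsMonadDerivation U δ) {X M : U.Algebra} (x : X ⟶ M)
    (y : X.A ⟶ M.A) (h : U.map y ≫ M.a + δ.app X.A ≫ X.a ≫ x.f = X.a ≫ y) :
    X ⟶ dualNumbers hδ M where
  f := biprod.lift x.f y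
  h := by
    have h1 : biprod.lift x.f y ≫ (dualNumbersFst hδ M).f = x.f := biprod.lift_fst _ _
    have h2 : biprod.lift x.f y ≫ dualNumbersSnd hδ M = y := biprod.lift_snd _ _
    let g : X.A ⟶ (dualNumbers hδ M).A := biprod.lift x.f y
    change g ≫ _ = _ at h1 h2
    change U.map g ≫ _ = X.a ≫ g
    clear_value g
    refine dualNumbers_hom_ext ?_ ?_
    · rw [Category.assoc, ← (dualNumbersFst hδ M).h, Category.assoc, h1, ← x.h,
        ← Category.assoc, ← U.map_comp, h1]
    · rw [Category.assoc, dualNumbers_a_snd, Category.assoc, h2, ← h, Preadditive.comp_add,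
        ← Category.assoc, ← U.map_comp, h2, ← Category.assoc (U.map _) (δ.app _), δ.naturality,
        Category.assoc, ← Category.assoc (U.map _) (U.map _), ← U.map_comp, h1, x.h]

theorem dualNumbersLift_fst (hδ : IsMonadDerivation U δ) {X M : U.Algebra} (x : X ⟶ M)
    (y : X.A ⟶ M.A) (h : U.map y ≫ M.a + δ.app X.A ≫ X.a ≫ x.f = X.a ≫ y) :
    dualNumbersLift hδ x y h ≫ dualNumbersFst hδ M = x := by
  ext
  exact biprod.lift_fst _ _

theorem dualNumbersLift_snd (hδ : IsMonadDerivation U δ) {X M : U.Algebra} (x : X ⟶ M)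
    (y : X.A ⟶ M.A) (h : U.map y ≫ M.a + δ.app X.A ≫ X.a ≫ x.f = X.a ≫ y) :
    (dualNumbersLift hδ x y h).f ≫ dualNumbersSnd hδ M = y :=
  biprod.lift_snd _ _

instance (hδ : IsMonadDerivation U δ) (M : U.Algebra) : Epi (dualNumbersFst hδ M) :=
  have : Epi (U.forget.map (dualNumbersFst hδ M)) := inferInstanceAs (Epi biprod.fst)
  U.forget.epi_of_epi_map this

/-- A morphism `X ⟶ M[ε]` of `U`-modules with zero constant coefficient factors through the inclusion
`M ⟶ M[ε]`, `x ↦ x ε`. -/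
theorem exists_dualNumbers_fac [PreservesFiniteColimits U.toFunctor]
    (hδ : IsMonadDerivation U δ) (M : U.Algebra) :
    ∃ i : M ⟶ dualNumbers hδ M, ∀ {X : U.Algebra} (g : X ⟶ dualNumbers hδ M),
      g ≫ dualNumbersFst hδ M = 0 → ∃ g' : X ⟶ M, g' ≫ i = g := by
  have h0 {X Y : U.Algebra} : (0 : X ⟶ Y).f = 0 := rfl
  refine ⟨dualNumbersLift hδ 0 (𝟙 _) ?_, fun {X} g hg => ⟨⟨g.f ≫ dualNumbersSnd hδ M, ?_⟩, ?_⟩⟩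
  · rw [h0, comp_zero, comp_zero, add_zero, U.map_id, Category.id_comp, Category.comp_id]
  · have hg' : g.f ≫ (dualNumbersFst hδ M).f = 0 := congrArg Monad.Algebra.Hom.f hg
    rw [← comp_dualNumbersSnd, hg', comp_zero, comp_zero, add_zero]
  · ext
    refine dualNumbers_hom_ext (congrArg Monad.Algebra.Hom.f (?_ : _ ≫ dualNumbersFst hδ M =
      g ≫ dualNumbersFst hδ M)) ?_
    · rw [Category.assoc, dualNumbersLift_fst, comp_zero, hg]
    · exact (Category.assoc _ _ _).trans
        ((congrArg _ (dualNumbersLift_snd hδ _ _ _)).trans (Category.comp_id _))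

end DualNumbers

theorem theorem4p5 {C : Type u} [Category.{v} C] [Abelian C] [IsGrothendieckAbelian.{v} C]
    {ι : Type v} (G : ι → C)
    (hG : (ObjectProperty.ofObj G).IsSeparating)
    (hGproj : ∀ i, Projective (G i))
    (hGfg : ∀ i, IsFinitelyGeneratedObject (G i))
    (U : Monad C) [PreservesFiniteLimits U.toFunctor] [PreservesColimits U.toFunctor]
    (δ : U.toFunctor ⟶ U.toFunctor) (hδ : IsMonadDerivation U δ)
    (τ : HereditaryTorsionTheory U.Algebra)
    (M : U.Algebra) (D : M.A ⟶ M.A) (hD : IsModuleDerivation U δ M D) :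
    Nonempty (τ.ModuleOfQuotients (fun i => U.free.obj (G i)) M) ∧
    ∀ H : τ.ModuleOfQuotients (fun i => U.free.obj (G i)) M,
      ∃! D' : H.obj.A ⟶ H.obj.A,
        IsModuleDerivation U δ H.obj D' ∧ H.unit.f ≫ D' = D ≫ H.unit.f := by
  have := isGrothendieckAbelian_algebra U
  have hP := isSeparating_free U hG
  have : ∀ i, Projective (U.free.obj (G i)) := fun i => projective_free U (G i)
  refine ⟨τ.nonempty_moduleOfQuotients _ M, fun H => ?_⟩
  obtain ⟨i, hi⟩ := exists_dualNumbers_fac hδ H.obj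
  have hH := H.isClosedOn hP
  have hE : τ.IsClosed (dualNumbers hδ H.obj) :=
    (HereditaryTorsionTheory.IsClosedOn.of_extension i (dualNumbersFst hδ H.obj) hH hH hi).isClosed
      hP
  have hder {X : U.Algebra} {D : X.A ⟶ X.A} : IsModuleDerivation U δ X D ↔
      U.map D ≫ X.a + δ.app X.A ≫ X.a ≫ (𝟙 X : X ⟶ X).f = X.a ≫ D := by
    rw [IsModuleDerivation, Preadditive.add_comp, Monad.Algebra.id_f, Category.comp_id]
  -- The morphism `x ↦ Φ x + Φ (D x) ε`, which extends to `H` because `H[ε]` is closed.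
  have hu : U.map (D ≫ H.unit.f) ≫ H.obj.a + δ.app M.A ≫ M.a ≫ H.unit.f =
      M.a ≫ D ≫ H.unit.f := by
    rw [U.map_comp, Category.assoc, H.unit.h, ← Category.assoc, ← Category.assoc (δ.app _),
      ← Preadditive.add_comp, ← Preadditive.add_comp, hD, Category.assoc]
  obtain ⟨g, hg⟩ := H.exists_unit_comp_eq hP hE (dualNumbersLift hδ H.unit (D ≫ H.unit.f) hu)
  have hg1 : g ≫ dualNumbersFst hδ H.obj = 𝟙 _ := H.hom_ext hP hH.torsionFree (by
    rw [← Category.assoc, hg, dualNumbersLift_fst, Category.comp_id])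
  refine ⟨g.f ≫ dualNumbersSnd hδ H.obj, ⟨?_, ?_⟩, fun D' hD' => ?_⟩
  · rw [hder, ← comp_dualNumbersSnd, ← hg1]
    rfl
  · rw [← Category.assoc]
    exact (congrArg (fun f => f.f ≫ dualNumbersSnd hδ H.obj) hg).trans
      (dualNumbersLift_snd hδ _ _ _)
  · have : dualNumbersLift hδ (𝟙 _) D' (hder.1 hD'.1) = g := by
      refine H.hom_ext hP hE.torsionFree ?_
      rw [hg]
      ext
      refine dualNumbers_hom_ext (congrArg Monad.Algebra.Hom.f (?_ : _ ≫ dualNumbersFst hδ _ =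
        _ ≫ dualNumbersFst hδ _)) ?_
      · rw [Category.assoc, dualNumbersLift_fst, dualNumbersLift_fst, Category.comp_id]
      · rw [dualNumbersLift_snd, Monad.Algebra.comp_f, Category.assoc, dualNumbersLift_snd, hD'.2]
    rw [← this, dualNumbersLift_snd]
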